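/- **Proposition (Noise injection).** Let $G$ be a locally compact, second countable Hausdorff group, let $\mathcal X,\mathcal Z$ be Polish spaces (with Borel $\sigma$-algebras) on which $G$ acts continuously, the action on $\mathcal X$ being proper, and let $X,Z$ be random variables in $\mathcal X,\mathcal Z$ on a common probability space. For random variables $X,W$ in $G$-spaces $\mathcal X,\mathcal W$, $P(W\mid X)$ is called *equivariant* if it has a regular version $\kappa$ with $\kappa(gx)=g\cdot\kappa(x)$ for all $g\in G$, $x\in\mathcal X$, where $g\cdot\nu$ is the push-forward of $\nu$ under $w\mapsto gw$. For a Polish $G$-space $\mathcal Y$, a measurable $f:\mathcal X\times\mathcal Z\times(0,1)\to\mathcal Y$ is called *jointly equivariant* if $f(gx,gz,e)=g f(x,z,e)$ for all $g\in G$, $e\in(0,1)$ and all $(x,z)$ in some $G$-invariant Borel set $S\subseteq\mathcal X\times\mathcal Z$ with $P((X,Z)\in S)=1$. For a random variable $Y$ in $\mathcal Y$, defined jointly with $X$ (possibly on another probability space than $Z$), we say that *$Y=f(X,Z,\epsilon)$ almost surely* if on some probability space there are random variables $X'',Y'',Z'',\epsilon$ such that $(X'',Y'')$ has the law of $(X,Y)$,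 $(X'',Z'')$ has the law of $(X,Z)$, $\epsilon\sim\mathrm{Unif}(0,1)$ is independent of $(X'',Z'')$, and $Y''=f(X'',Z'',\epsilon)$ almost surely. The following are equivalent: 1. $G$ acts freely on $\mathcal X\times\mathcal Z$ up to a set of probability zero (that is, almost surely no $g\neq e$ fixes both $X$ and $Z$), and $P(Z\mid X)$ is equivariant; 2. for every Polish space $\mathcal Y$ with a continuous $G$-action and every random variable $Y$ in $\mathcal Y$ (defined jointly with $X$), $P(Y\mid X)$ is equivariant if and only if there is a jointly equivariant $f$ such that $Y=f(X,Z,\epsilon)$ almost surely; 3. the same as 2, for every Polish space $\mathcal Y$ with a proper continuous $G$-action. In particular, 2 and 3 hold whenever $G$ acts freely on $\mathcal Z$ up to a set of probability zero and $P(Z\mid X)$ is equivariant. -/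

import Mathlib

open MeasureTheory ProbabilityTheory

universe u v

/-- The conditional distribution of `Y` given `X` is `G`-equivariant: it has a regular version
`κ`, viewed as a map from points `x` to probability measures, with `κ (g x) = g · κ x` for all
`g` and `x`, where `g · ν` is the push-forward of `ν` under the action of `g`. -/
def EquivariantCondDistrib (G : Type*) [Group G] {Ω 𝒳 𝒴 : Type*}
    [MeasurableSpace Ω] [MeasurableSpace 𝒳] [MeasurableSpace 𝒴] [MulAction G 𝒳] [MulAction G 𝒴]
    (P : Measure Ω) (Y : Ω → 𝒴) (X : Ω → 𝒳) : Prop :=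
  ∃ κ : Kernel 𝒳 𝒴, IsMarkovKernel κ ∧
    (∀ (g : G) (x : 𝒳), κ (g • x) = (κ x).map (fun y => g • y)) ∧
    P.map (fun ω => (X ω, Y ω)) = (P.map X).compProd κ

/-- `G` acts freely on `𝒲` up to a `ρ`-null set: almost every point has trivial stabilizer. -/
def EssentiallyFree (G : Type*) [Group G] {𝒲 : Type*} [MeasurableSpace 𝒲] [MulAction G 𝒲]
    (ρ : Measure 𝒲) : Prop :=
  ∀ᵐ w ∂ρ, MulAction.stabilizer G w = ⊥

/-- `f (x, z, e)` is equivariant jointly in `(x, z)`, off a `G`-invariant `ρ`-null set of pairs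
`(x, z)`. -/
def JointlyEquivariant (G : Type*) [Group G] {𝒳 𝒵 E 𝒴 : Type*}
    [MeasurableSpace 𝒳] [MeasurableSpace 𝒵] [MulAction G 𝒳] [MulAction G 𝒵] [MulAction G 𝒴]
    (ρ : Measure (𝒳 × 𝒵)) (f : 𝒳 × 𝒵 × E → 𝒴) : Prop :=
  ∃ S : Set (𝒳 × 𝒵), MeasurableSet S ∧ (∀ (g : G), ∀ w ∈ S, g • w ∈ S) ∧ (∀ᵐ w ∂ρ, w ∈ S) ∧
    ∀ (g : G) (x : 𝒳) (z : 𝒵) (e : E), (x, z) ∈ S → f (g • x, g • z, e) = g • f (x, z, e)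

/-- `Y' = f (X', Z', ε)` almost surely, for a measurable jointly equivariant `f` and
`ε ~ Unif(0,1)` independent of `(X', Z')`. As always with noise outsourcing, the noise may live on
another probability space than the given variables: on `Ω''` there are a copy of the pair
`(X', Y')`, a copy of the pair `(X, Z)` with the same first component, and the variable `ε`. -/
def NoiseRepresentable (G : Type u) [Group G] {𝒳 𝒵 𝒴 : Type u} {Ω Ω' : Type*}
    [MeasurableSpace Ω] [MeasurableSpace Ω']
    [MeasurableSpace 𝒳] [MeasurableSpace 𝒵] [MeasurableSpace 𝒴]
    [MulAction G 𝒳] [MulAction G 𝒵] [MulAction G 𝒴]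
    (P : Measure Ω) (X : Ω → 𝒳) (Z : Ω → 𝒵) (P' : Measure Ω') (X' : Ω' → 𝒳) (Y' : Ω' → 𝒴) :
    Prop :=
  ∃ f : 𝒳 × 𝒵 × Set.Ioo (0 : ℝ) 1 → 𝒴, Measurable f ∧
    JointlyEquivariant G (P.map (fun ω => (X ω, Z ω))) f ∧
    ∃ (Ω'' : Type u) (_ : MeasurableSpace Ω'') (P'' : Measure Ω'') (X'' : Ω'' → 𝒳)
      (Y'' : Ω'' → 𝒴) (Z'' : Ω'' → 𝒵) (ε : Ω'' → Set.Ioo (0 : ℝ) 1),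
      IsProbabilityMeasure P'' ∧
      IdentDistrib (fun ω => (X'' ω, Y'' ω)) (fun ω => (X' ω, Y' ω)) P'' P' ∧
      IdentDistrib (fun ω => (X'' ω, Z'' ω)) (fun ω => (X ω, Z ω)) P'' P ∧
      AEMeasurable ε P'' ∧ P''.map ε = (volume : Measure ℝ).comap Subtype.val ∧
      IndepFun ε (fun ω => (X'' ω, Z'' ω)) P'' ∧
      ∀ᵐ ω ∂P'', Y'' ω = f (X'' ω, Z'' ω, ε ω)

/-- For every random variable `Y'` in `𝒴`, defined jointly with a copy `X'` of `X`, the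
conditional distribution of `Y'` given `X'` is equivariant if and only if `Y'` is a jointly
equivariant function of the input, of `Z`, and of independent uniform noise. -/
def NoiseCharacterizes (G : Type u) [Group G] {𝒳 𝒵 : Type u} {Ω : Type v}
    [MeasurableSpace Ω] [MeasurableSpace 𝒳] [MeasurableSpace 𝒵]
    [MulAction G 𝒳] [MulAction G 𝒵] (P : Measure Ω) (X : Ω → 𝒳) (Z : Ω → 𝒵)
    (𝒴 : Type u) [MeasurableSpace 𝒴] [MulAction G 𝒴] : Prop :=
  ∀ (Ω' : Type u) [MeasurableSpace Ω'] (P' : Measure Ω') [IsProbabilityMeasure P']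
    (X' : Ω' → 𝒳) (Y' : Ω' → 𝒴), Measurable X' → Measurable Y' → IdentDistrib X' X P' P →
    (EquivariantCondDistrib G P' Y' X' ↔ NoiseRepresentable G P X Z P' X' Y')

section Auxiliary

open Topology Filter TopologicalSpace
open scoped ENNReal

/-! From 1 to 2: the diagonal action on pairs is proper, so its free part carries a Borel `τ` with
`τ (g • w) = g * τ w` (`exists_measurable_equivariant_to_group`). An equivariant kernel `κ` is
realized by a function `F` of a point and uniform noise, and `f (x, z, e) = τ • F (τ⁻¹ • x, e)` with
`τ = τ (x, z)` is jointly equivariant with conditional law `τ · κ (τ⁻¹ x) = κ x`. Conversely,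
integrating a jointly equivariant `f` over `z ~ P(Z | X = x)` and `e` gives a kernel that is
equivariant on an invariant set of full measure. Elsewhere it is replaced by means of an equivariant
Markov kernel to `G`, built from Haar measure (`exists_equivariant_kernel_to_group`).

From 3 to 1, two proper test spaces suffice. On `𝒳 × 𝒵` the pair `(X, Z)` represents itself, so its
conditional law given `X`, and hence that of `Z`, is equivariant. On `G` the kernel above supplies a
variable with equivariant conditional law. Its representing function is equivariant into `G`, where
translation is free, so almost every pair has trivial stabilizer. -/

/-- A locally compact, second countable Hausdorff group is Polish. -/
theorem PolishSpace.of_locallyCompactGroup (G : Type*) [Group G] [TopologicalSpace G]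
    [IsTopologicalGroup G] [LocallyCompactSpace G] [SecondCountableTopology G] [T2Space G] :
    PolishSpace G := by
  let _ := IsTopologicalGroup.rightUniformSpace G
  have : IsRightUniformGroup G := ⟨rfl⟩
  have : CompleteSpace G := IsRightUniformGroup.completeSpace_of_weaklyLocallyCompactSpace
  have : (uniformity G).IsCountablyGenerated := Filter.comap.isCountablyGenerated _ _
  have : IsCompletelyMetrizableSpace G := inferInstance
  exact {}

/-! ### Proper actions and their orbits -/

/-- If `G` acts properly on the first factor, the diagonal action on the product is proper. -/
instance (priority := 50) ProperSMul.prod {G X Z : Type*} [Group G] [TopologicalSpace G]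
    [TopologicalSpace X] [TopologicalSpace Z] [T2Space X] [T2Space Z] [MulAction G X]
    [MulAction G Z] [ProperSMul G X] [ContinuousSMul G Z] : ProperSMul G (X × Z) := by
  rw [properSMul_iff_continuousSMul_ultrafilter_tendsto_t2]
  refine ⟨inferInstance, fun 𝒰 w₁ w₂ h => ?_⟩
  obtain ⟨-, hX⟩ := (properSMul_iff_continuousSMul_ultrafilter_tendsto_t2 (G := G) (X := X)).1
    inferInstance
  -- In the ultrafilter criterion only the group component has to converge, and the first coordinate
  -- already forces that.
  obtain ⟨g, hg⟩ := hX (𝒰.map fun p => (p.1, p.2.1)) w₁.1 w₂.1 <| by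
    have h' := (((continuous_fst.comp continuous_fst).prodMk
      (continuous_fst.comp continuous_snd)).tendsto (w₁, w₂)).comp h
    exact tendsto_map'_iff.2 h'
  exact ⟨g, tendsto_map'_iff.1 hg⟩

theorem stabilizer_smul_eq_bot_iff {G W : Type*} [Group G] [MulAction G W] (g : G) (w : W) :
    MulAction.stabilizer G (g • w) = ⊥ ↔ MulAction.stabilizer G w = ⊥ := by
  rw [MulAction.stabilizer_smul_eq_stabilizer_map_conj]
  exact Subgroup.map_eq_bot_iff_of_injective _ (MulAut.conj g).injective

section Orbits

variable {G W : Type*} [Group G] [TopologicalSpace G] [TopologicalSpace W] [MulAction G W]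

/-- The orbit of `w` is a slice of the range of `(g, x) ↦ (g • x, x)`, which is closed because this
map is proper. -/
theorem MulAction.isClosed_orbit_of_properSMul [ProperSMul G W] (w : W) :
    IsClosed (MulAction.orbit G w) := by
  have h : IsClosed (Set.range fun gx : G × W => (gx.1 • gx.2, gx.2)) :=
    ProperSMul.isProperMap_smul_pair.isClosedMap.isClosed_range
  convert! h.preimage (Continuous.prodMk_left w) using 1
  ext y
  simp [MulAction.mem_orbit_iff]

/-- The points with trivial stabilizer of a proper action form a Borel set. -/
theorem measurableSet_stabilizer_eq_bot [T2Space W] [PseudoMetrizableSpace G] [T1Space G]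
    [ProperSMul G W]
    [MeasurableSpace W] [BorelSpace W] : MeasurableSet {w : W | MulAction.stabilizer G w = ⊥} := by
  let _ := pseudoMetrizableSpacePseudoMetric G
  -- The open set `{1}ᶜ` is a countable union of closed sets `F n`. The proper map sends each `F n ×
  -- W` to a closed set, so the non-free points form an Fσ set.
  obtain ⟨F, hF, -, hFU, -⟩ := (isOpen_compl_singleton (x := (1 : G))).exists_iUnion_isClosed
  have key : {w : W | MulAction.stabilizer G w = ⊥}ᶜ = ⋃ n, (fun w : W => (w, w)) ⁻¹'
      ((fun gx : G × W => (gx.1 • gx.2, gx.2)) '' (F n ×ˢ Set.univ)) := by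
    ext w
    simp only [Set.mem_compl_iff, Set.mem_ofPred_eq, Set.mem_iUnion, Set.mem_preimage,
      Set.mem_image, Set.mem_prod, Set.mem_univ, and_true, Prod.mk.injEq, Prod.exists]
    rw [Subgroup.eq_bot_iff_forall]
    push Not
    constructor
    · rintro ⟨g, hg, hg1⟩
      have : g ∈ ⋃ n, F n := by rw [hFU]; exact hg1
      obtain ⟨n, hn⟩ := Set.mem_iUnion.1 this
      exact ⟨n, g, w, hn, hg, rfl⟩
    · rintro ⟨n, g, _, hn, hg, rfl⟩
      have : g ∈ ({1} : Set G)ᶜ := by rw [← hFU]; exact Set.mem_iUnion.2 ⟨n, hn⟩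
      exact ⟨g, hg, this⟩
  rw [← MeasurableSet.compl_iff, key]
  refine MeasurableSet.iUnion fun n => (IsClosed.preimage (by fun_prop) ?_).measurableSet
  exact ProperSMul.isProperMap_smul_pair.isClosedMap _ ((hF n).prod isClosed_univ)

end Orbits

/-! ### Borel selectors and equivariant maps to the group -/

/-- The measurable selection theorem of Kuratowski and Ryll-Nardzewski. -/
theorem exists_measurable_selection {Y W : Type*} [MeasurableSpace Y] [TopologicalSpace W]
    [PolishSpace W] [MeasurableSpace W] [BorelSpace W] (F : Y → Set W) (hc : ∀ y, IsClosed (F y))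
    (hne : ∀ y, (F y).Nonempty)
    (hF : ∀ U : Set W, IsOpen U → MeasurableSet {y | (F y ∩ U).Nonempty}) :
    ∃ s : Y → W, Measurable s ∧ ∀ y, s y ∈ F y := by
  classical
  rcases isEmpty_or_nonempty Y with hY | ⟨⟨y₀⟩⟩
  · exact ⟨fun y => (hne y).some, measurable_of_empty _, fun y => (hne y).some_mem⟩
  have : Nonempty W := ⟨(hne y₀).some⟩
  let _ := upgradeIsCompletelyMetrizable W
  let q := TopologicalSpace.denseSeq W
  have hq : ∀ (w : W) (r : ℝ), 0 < r → ∃ i, w ∈ Metric.ball (q i) r := fun w r hr => by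
    obtain ⟨i, hi⟩ := (TopologicalSpace.denseRange_denseSeq W).exists_dist_lt w hr
    exact ⟨i, hi⟩
  let r : ℕ → ℝ := fun k => (1 / 2) ^ k
  have hr : ∀ k, 0 < r k := fun k => by positivity
  let Good : ℕ → (Y → ℕ) → Prop := fun k a =>
    Measurable a ∧ ∀ y, (F y ∩ Metric.ball (q (a y)) (r k)).Nonempty
  -- Taking the least admissible index makes the choice measurable. `B y` will be the previous ball,
  -- so that consecutive balls share a point of `F y` and their centers form a Cauchy sequence.
  have step : ∀ (B : Y → Set W), (∀ y, (F y ∩ B y).Nonempty) →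
      (∀ U, IsOpen U → MeasurableSet {y | (F y ∩ (B y ∩ U)).Nonempty}) → ∀ k,
      ∃ a : Y → ℕ, Measurable a ∧ ∀ y, (F y ∩ (B y ∩ Metric.ball (q (a y)) (r k))).Nonempty := by
    intro B hB hBm k
    have hex : ∀ y, ∃ i, (F y ∩ (B y ∩ Metric.ball (q i) (r k))).Nonempty := fun y => by
      obtain ⟨w, hw, hwB⟩ := hB y
      obtain ⟨i, hi⟩ := hq w (r k) (hr k)
      exact ⟨i, w, hw, hwB, hi⟩
    exact ⟨fun y => Nat.find (hex y), measurable_find hex fun i => hBm _ Metric.isOpen_ball,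
      fun y => Nat.find_spec (hex y)⟩
  have h0 : ∃ a, Good 0 a := by
    obtain ⟨a, ha, h⟩ := step (fun _ => Set.univ) (by simpa using hne) (by simpa using hF) 0
    exact ⟨a, ha, by simpa using h⟩
  have hS : ∀ k (a : {a // Good k a}), ∃ b : {b // Good (k + 1) b},
      ∀ y, dist (q (a.1 y)) (q (b.1 y)) ≤ r k + r (k + 1) := by
    rintro k ⟨a, ha, h⟩
    obtain ⟨b, hb, h'⟩ := step (fun y => Metric.ball (q (a y)) (r k)) h (fun U hU => by
      -- The previous ball depends on `y` only through the countably valued `a`, so the condition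
      -- splits into pieces with a fixed ball.
      have : {y | (F y ∩ (Metric.ball (q (a y)) (r k) ∩ U)).Nonempty} =
          ⋃ i, (a ⁻¹' {i} ∩ {y | (F y ∩ (Metric.ball (q i) (r k) ∩ U)).Nonempty}) := by
        ext y; simp
      rw [this]
      exact MeasurableSet.iUnion fun i => (ha (measurableSet_singleton i)).inter
        (hF _ (Metric.isOpen_ball.inter hU))) (k + 1)
    refine ⟨⟨b, hb, fun y => (h' y).mono fun w hw => ⟨hw.1, hw.2.2⟩⟩, fun y => ?_⟩
    obtain ⟨w, -, hw1, hw2⟩ := h' y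
    rw [Metric.mem_ball, dist_comm] at hw1
    rw [Metric.mem_ball] at hw2
    exact (dist_triangle _ w _).trans (add_le_add hw1.le hw2.le)
  choose next hnext using hS
  let a : ∀ k, {a // Good k a} := fun k => Nat.rec ⟨h0.choose, h0.choose_spec⟩ next k
  have ha : ∀ k y, dist (q ((a k).1 y)) (q ((a (k + 1)).1 y)) ≤ 2 * (1 / 2) ^ k := fun k y => by
    refine (hnext k (a k) y).trans ?_
    have : r (k + 1) ≤ r k := pow_le_pow_of_le_one (by norm_num) (by norm_num) k.le_succ
    change r k + r (k + 1) ≤ 2 * r k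
    linarith
  have hlim : ∀ y, ∃ w, Tendsto (fun k => q ((a k).1 y)) atTop (𝓝 w) := fun y =>
    cauchySeq_tendsto_of_complete
      (cauchySeq_of_le_geometric (1 / 2) 2 (by norm_num) fun k => ha k y)
  choose s hs using hlim
  refine ⟨s, measurable_of_tendsto_metrizable
    (fun k => (measurable_from_nat (f := q)).comp (a k).2.1) (tendsto_pi_nhds.2 hs), fun y => ?_⟩
  -- The limit lies in `F y`: it is also the limit of points of the closed set `F y` within `r k` of
  -- the approximants.
  choose w hw using fun k => (a k).2.2 y
  refine (hc y).mem_of_tendsto (f := w) (b := atTop) ?_ (Eventually.of_forall fun k => (hw k).1)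
  refine (hs y).congr_dist ?_
  refine squeeze_zero (fun _ => dist_nonneg) (fun k => ?_)
    (tendsto_pow_atTop_nhds_zero_of_lt_one (r := (1 / 2 : ℝ)) (by norm_num) (by norm_num))
  rw [dist_comm]
  exact (Metric.mem_ball.1 (hw k).2).le

/-- A proper action on a Polish space has a Borel selector for its orbits. -/
theorem exists_measurable_orbit_selector (G : Type*) {W : Type*} [Group G] [TopologicalSpace G]
    [TopologicalSpace W] [PolishSpace W] [MeasurableSpace W] [BorelSpace W] [MulAction G W]
    [ProperSMul G W] :
    ∃ s : W → W, Measurable s ∧ (∀ (g : G) w, s (g • w) = s w) ∧ ∀ w, ∃ g : G, g • s w = w := by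
  -- Selection is parametrized by the orbit space with its quotient σ-algebra. This needs no
  -- topology there, and composing with `π` makes the selector invariant.
  let π : W → MulAction.orbitRel.Quotient G W := Quotient.mk''
  have hm : ∀ U : Set W, IsOpen U →
      MeasurableSet {y : MulAction.orbitRel.Quotient G W | (y.orbit ∩ U).Nonempty} := by
    intro U hU
    rw [measurableSet_quotient]
    have : Quotient.mk'' ⁻¹' {y : MulAction.orbitRel.Quotient G W | (y.orbit ∩ U).Nonempty} =
        ⋃ g : G, (fun w : W => g • w) ⁻¹' U := by
      ext w
      simp only [Set.mem_preimage, Set.mem_ofPred_eq, MulAction.orbitRel.Quotient.orbit_mk,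
        Set.mem_iUnion]
      constructor
      · rintro ⟨_, ⟨g, rfl⟩, hg⟩
        exact ⟨g, hg⟩
      · rintro ⟨g, hg⟩
        exact ⟨_, ⟨g, rfl⟩, hg⟩
    rw [this]
    exact (isOpen_iUnion fun g => hU.preimage (continuous_const_smul g)).measurableSet
  have hc : ∀ y : MulAction.orbitRel.Quotient G W, IsClosed y.orbit := fun y =>
    Quotient.inductionOn' y fun w => MulAction.isClosed_orbit_of_properSMul w
  obtain ⟨s, hs, h⟩ := exists_measurable_selection
    (fun y : MulAction.orbitRel.Quotient G W => y.orbit) hc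
    MulAction.orbitRel.Quotient.nonempty_orbit hm
  refine ⟨s ∘ π, hs.comp measurable_quotient_mk'', fun g w => ?_, fun w => ?_⟩
  · have : π (g • w) = π w := Quotient.sound' ⟨g, rfl⟩
    simp [this]
  · obtain ⟨g, hg⟩ := h (π w)
    exact ⟨g⁻¹, by simp [← hg]⟩

/-- On the free part of a proper action there is a measurable equivariant map to the group. -/
theorem exists_measurable_equivariant_to_group (G : Type*) {W : Type*} [Group G]
    [TopologicalSpace G] [PolishSpace G] [MeasurableSpace G] [BorelSpace G] [TopologicalSpace W]
    [PolishSpace W] [MeasurableSpace W] [BorelSpace W] [MulAction G W] [ProperSMul G W] :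
    ∃ τ : W → G, Measurable τ ∧ ∀ w, MulAction.stabilizer G w = ⊥ →
      ∀ g : G, τ (g • w) = g * τ w := by
  rcases isEmpty_or_nonempty W with hW | ⟨⟨w₀⟩⟩
  · exact ⟨fun _ => 1, measurable_const, fun w => isEmptyElim w⟩
  obtain ⟨s, hs, hinv, horb⟩ := exists_measurable_orbit_selector G (W := W)
  let S : Set W := {w | MulAction.stabilizer G w = ⊥}
  have hS : MeasurableSet S := measurableSet_stabilizer_eq_bot
  rcases S.eq_empty_or_nonempty with hSe | ⟨w₁, hw₁⟩
  · exact ⟨fun _ => 1, measurable_const, fun w hw => by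
      have : w ∈ S := hw
      simp [hSe] at this⟩
  have : Nonempty (G × S) := ⟨(1, ⟨w₁, hw₁⟩)⟩
  have := hS.standardBorel
  -- Over free points `g` is determined by `(g • w, w)`. An injective Borel map between standard
  -- Borel spaces has a Borel inverse on its range, so `g` is recovered measurably; `τ w` is then
  -- the element moving the representative `s w` to `w`.
  let φ : G × S → W × W := fun p => (p.1 • p.2.1, p.2.1)
  have hφ : Measurable φ := by fun_prop
  have hinj : Function.Injective φ := by
    rintro ⟨g, w, hw⟩ ⟨g', w', hw'⟩ h
    obtain ⟨h1, h2⟩ : g • w = g' • w' ∧ w = w' := by simpa [φ] using h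
    subst h2
    have : g'⁻¹ * g ∈ MulAction.stabilizer G w := by
      rw [MulAction.mem_stabilizer_iff, mul_smul, h1, inv_smul_smul]
    rw [show MulAction.stabilizer G w = ⊥ from hw, Subgroup.mem_bot, inv_mul_eq_one] at this
    simp [this]
  have hemb : MeasurableEmbedding φ := hφ.measurableEmbedding hinj
  let τ : W → G := fun w => (hemb.invFun (w, s w)).1
  have key : ∀ w, MulAction.stabilizer G w = ⊥ → ∀ g : G, g • s w = w → τ w = g := by
    intro w hw g hg
    have hsw : s w ∈ S := by
      rw [← hg, stabilizer_smul_eq_bot_iff] at hw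
      exact hw
    have : hemb.invFun (w, s w) = (g, ⟨s w, hsw⟩) := by
      rw [← hemb.leftInverse_invFun (g, ⟨s w, hsw⟩)]
      simp [φ, hg]
    simp [τ, this]
  refine ⟨τ, (hemb.measurable_invFun.comp (measurable_id.prodMk hs)).fst, fun w hw g => ?_⟩
  obtain ⟨k, hk⟩ := horb w
  rw [key w hw k hk]
  exact key _ ((stabilizer_smul_eq_bot_iff g w).2 hw) _ (by rw [hinv, mul_smul, hk])

/-! ### Haar averaging along orbits -/

/-- Every point of a proper space over a locally compact group has a neighborhood whose set of
return elements is relatively compact. -/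
theorem exists_isOpen_compact_return {G X : Type*} [Group G] [TopologicalSpace G]
    [LocallyCompactSpace G] [TopologicalSpace X] [T1Space X] [MulAction G X] [ProperSMul G X]
    (x₀ : X) : ∃ U : Set X, IsOpen U ∧ x₀ ∈ U ∧ ∃ C : Set G, IsCompact C ∧
      ∀ (g : G) (x : X), x ∈ U → g • x ∈ U → g ∈ C := by
  have hp : IsProperMap fun gx : G × X => (gx.1 • gx.2, gx.2) := ProperSMul.isProperMap_smul_pair
  -- The stabilizer of `x₀` is compact, as the projection of a fiber of the proper map; `C` is a
  -- compact set with that stabilizer in its interior.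
  obtain ⟨C, hC, hKC⟩ := exists_compact_superset
    ((hp.isCompact_preimage (isCompact_singleton (x := (x₀, x₀)))).image continuous_fst)
  have hD : IsClosed ((fun gx : G × X => (gx.1 • gx.2, gx.2)) '' ((interior C)ᶜ ×ˢ Set.univ)) :=
    hp.isClosedMap _ (isOpen_interior.isClosed_compl.prod isClosed_univ)
  have h0 : (x₀, x₀) ∈
      ((fun gx : G × X => (gx.1 • gx.2, gx.2)) '' ((interior C)ᶜ ×ˢ Set.univ))ᶜ := by
    rintro ⟨⟨g, x⟩, ⟨hg, -⟩, h⟩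
    exact hg (hKC ⟨(g, x), h, rfl⟩)
  obtain ⟨U, V, hU, hV, hxU, hxV, hUV⟩ := isOpen_prod_iff.1 hD.isOpen_compl _ _ h0
  refine ⟨U ∩ V, hU.inter hV, ⟨hxU, hxV⟩, C, hC, fun g x hx hgx => ?_⟩
  by_contra hg
  exact hUV (Set.mk_mem_prod hgx.1 hx.2)
    ⟨(g, x), ⟨fun h => hg (interior_subset h), Set.mem_univ _⟩, rfl⟩

/-- A proper action admits a measurable function with positive and finite orbit integrals. -/
theorem exists_lintegral_orbit_pos_finite {G X : Type*} [Group G] [TopologicalSpace G]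
    [IsTopologicalGroup G] [LocallyCompactSpace G] [SecondCountableTopology G]
    [MeasurableSpace G] [BorelSpace G] [TopologicalSpace X] [T1Space X]
    [SecondCountableTopology X] [MeasurableSpace X] [BorelSpace X] [MulAction G X]
    [ProperSMul G X] (μ : Measure G) [μ.IsHaarMeasure] :
    ∃ h : X → ℝ≥0∞, Measurable h ∧ ∀ x, ∫⁻ g, h (g⁻¹ • x) ∂μ ≠ 0 ∧ ∫⁻ g, h (g⁻¹ • x) ∂μ ≠ ∞ := by
  choose U hU hxU C hC hUC using exists_isOpen_compact_return (G := G) (X := X)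
  obtain ⟨s, hs, hcov⟩ := TopologicalSpace.countable_cover_nhds fun x => (hU x).mem_nhds (hxU x)
  have := hs.to_subtype
  -- The weights are positive and so small that the bounds `μ (C i)⁻¹`, which do not depend on `x`,
  -- have weighted sum below 1.
  obtain ⟨c, hc0, hc⟩ := ENNReal.exists_pos_tsum_mul_lt_of_countable one_ne_zero
    (fun i : s => μ (C i)⁻¹) fun i => (hC i).inv.measure_lt_top.ne
  have hm : ∀ (i : X) (x : X), MeasurableSet {g : G | g⁻¹ • x ∈ U i} := fun i x =>
    ((hU i).preimage (by fun_prop : Continuous fun g : G => g⁻¹ • x)).measurableSet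
  have hle : ∀ (i : X) (x : X), μ {g : G | g⁻¹ • x ∈ U i} ≤ μ (C i)⁻¹ := by
    intro i x
    rcases Set.eq_empty_or_nonempty {g : G | g⁻¹ • x ∈ U i} with h | ⟨k, hk⟩
    · simp [h]
    -- If `k⁻¹ • x` and `g⁻¹ • x` both lie in `U i`, then `g⁻¹ * k ∈ C i`. The whole set thus lies
    -- in the left translate of `(C i)⁻¹` by `k`, which has the same Haar measure.
    · rw [← measure_preimage_mul μ k⁻¹ (C i)⁻¹]
      refine measure_mono fun g hg => ?_
      have := hUC i (g⁻¹ * k) (k⁻¹ • x) hk (by rw [mul_smul, smul_inv_smul]; exact hg)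
      simpa using this
  have hint : ∀ x, ∫⁻ g, (∑' i : s, (U i).indicator (fun _ => c i) (g⁻¹ • x)) ∂μ =
      ∑' i : s, c i * μ {g : G | g⁻¹ • x ∈ U i} := by
    intro x
    have heq : ∀ (i : s) (g : G), (U i).indicator (fun _ => (c i : ℝ≥0∞)) (g⁻¹ • x) =
        {g : G | g⁻¹ • x ∈ U i}.indicator (fun _ => (c i : ℝ≥0∞)) g := fun i g => rfl
    simp_rw [heq]
    rw [lintegral_tsum fun i : s => (measurable_const.indicator (hm i x)).aemeasurable]
    exact tsum_congr fun i => by rw [lintegral_indicator_const (hm i x)]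
  refine ⟨fun x => ∑' i : s, (U i).indicator (fun _ => (c i : ℝ≥0∞)) x,
    Measurable.tsum fun i => measurable_const.indicator (hU i).measurableSet,
    fun x => ?_⟩
  rw [hint]
  constructor
  · have hx : x ∈ ⋃ x ∈ s, U x := by rw [hcov]; trivial
    obtain ⟨i, hi, hxi⟩ := Set.mem_iUnion₂.1 hx
    intro h0
    have h1 := ENNReal.tsum_eq_zero.1 h0 ⟨i, hi⟩
    have hpos : 0 < μ {g : G | g⁻¹ • x ∈ U i} :=
      IsOpen.measure_pos μ ((hU i).preimage (by fun_prop)) ⟨1, by simpa using hxi⟩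
    rcases mul_eq_zero.1 h1 with h | h
    · exact (hc0 ⟨i, hi⟩).ne' (by exact_mod_cast h)
    · exact hpos.ne' h
  · refine ((ENNReal.tsum_le_tsum fun i => ?_).trans_lt (hc.trans ENNReal.one_lt_top)).ne
    rw [mul_comm]
    exact mul_le_mul_left (hle i x) _

/-- A proper action of a locally compact group admits an equivariant Markov kernel to the group. -/
theorem exists_equivariant_kernel_to_group (G X : Type*) [Group G] [TopologicalSpace G]
    [IsTopologicalGroup G] [LocallyCompactSpace G] [SecondCountableTopology G]
    [MeasurableSpace G] [BorelSpace G] [TopologicalSpace X] [T1Space X]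
    [SecondCountableTopology X] [MeasurableSpace X] [BorelSpace X] [MulAction G X]
    [ProperSMul G X] :
    ∃ ρ : Kernel X G, IsMarkovKernel ρ ∧ ∀ (g : G) x, ρ (g • x) = (ρ x).map (fun k => g • k) := by
  let μ : Measure G := Measure.haar
  obtain ⟨h, hh, hH⟩ := exists_lintegral_orbit_pos_finite (X := X) μ
  have hjoint : Measurable fun p : X × G => h (p.2⁻¹ • p.1) := by fun_prop
  let H : X → ℝ≥0∞ := fun x => ∫⁻ g, h (g⁻¹ • x) ∂μ
  have hHm : Measurable H := hjoint.lintegral_prod_right'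
  have hHinv : ∀ (g : G) x, H (g • x) = H x := fun g x => by
    change ∫⁻ k, h (k⁻¹ • g • x) ∂μ = ∫⁻ k, h (k⁻¹ • x) ∂μ
    rw [← lintegral_mul_left_eq_self _ g]
    simp [mul_smul]
  -- Since `H` is invariant, `d (g • x) (g * k) = d x k`. With left invariance of `μ`, the kernel
  -- with density `d` is equivariant.
  let d : X → G → ℝ≥0∞ := fun x g => h (g⁻¹ • x) / H x
  have hd : Measurable (Function.uncurry d) := hjoint.div (hHm.comp measurable_fst)
  have happ : ∀ x s, (Kernel.const X μ).withDensity d x s = ∫⁻ g in s, d x g ∂μ := fun x s => by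
    rw [Kernel.withDensity_apply' _ hd, Kernel.const_apply]
  refine ⟨(Kernel.const X μ).withDensity d, ⟨fun x => ⟨?_⟩⟩, fun g x => ?_⟩
  · rw [happ, Measure.restrict_univ]
    have hdx : Measurable fun g => h (g⁻¹ • x) := hjoint.comp measurable_prodMk_left
    simp only [d, div_eq_mul_inv]
    rw [lintegral_mul_const _ hdx]
    exact ENNReal.mul_inv_cancel (hH x).1 (hH x).2
  · ext s hs
    have hg : Measurable fun k : G => g • k := measurable_const_smul g
    rw [Measure.map_apply hg hs, happ, happ, ← lintegral_indicator hs,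
      ← lintegral_indicator (hg hs), ← lintegral_mul_left_eq_self _ g]
    refine lintegral_congr fun k => ?_
    simp only [Set.indicator, Set.mem_preimage, smul_eq_mul, d, hHinv, mul_inv_rev, mul_smul,
      inv_smul_smul]
    rfl

/-! ### Uniform noise and representability in terms of laws -/

/-- The uniform distribution on the open unit interval. -/
noncomputable abbrev uniformIoo : Measure (Set.Ioo (0 : ℝ) 1) :=
  (volume : Measure ℝ).comap Subtype.val

instance isProbabilityMeasure_uniformIoo : IsProbabilityMeasure uniformIoo where
  measure_univ := by
    rw [comap_subtype_coe_apply measurableSet_Ioo, Set.image_univ, Subtype.range_coe]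
    simp

/-- The inclusion of the open unit interval in the closed one preserves Lebesgue measure. -/
theorem map_inclusion_Ioo_unitInterval :
    uniformIoo.map (Set.inclusion Set.Ioo_subset_Icc_self) =
      (volume : Measure unitInterval) := by
  have hi : Measurable (Set.inclusion (Set.Ioo_subset_Icc_self (a := (0 : ℝ)) (b := 1))) :=
    measurable_inclusion _
  have h1 : (volume : Measure unitInterval).map Subtype.val =
      (volume : Measure ℝ).restrict (Set.Icc 0 1) :=
    unitInterval.measurePreserving_coe.map_eq
  have h2 : uniformIoo.map Subtype.val =
      (volume : Measure ℝ).restrict (Set.Ioo 0 1) :=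
    map_comap_subtype_coe measurableSet_Ioo _
  have h3 : (uniformIoo.map
      (Set.inclusion Set.Ioo_subset_Icc_self)).map Subtype.val =
      (volume : Measure unitInterval).map Subtype.val := by
    rw [Measure.map_map measurable_subtype_coe hi, h1, ← Measure.restrict_congr_set Ioo_ae_eq_Icc,
      ← h2]
    rfl
  rw [← unitInterval.measurableEmbedding_coe.comap_map (volume : Measure unitInterval), ← h3,
    unitInterval.measurableEmbedding_coe.comap_map]

/-- A Markov kernel to a standard Borel space is the law of a measurable function of a point and
of a uniform variable in the open unit interval. -/
theorem ProbabilityTheory.Kernel.exists_measurable_map_eq_Ioo {X Y : Type*} [MeasurableSpace X]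
    [MeasurableSpace Y] [StandardBorelSpace Y] [Nonempty Y] (κ : Kernel X Y) [IsMarkovKernel κ] :
    ∃ F : X × Set.Ioo (0 : ℝ) 1 → Y, Measurable F ∧
      ∀ x, uniformIoo.map (fun e => F (x, e)) = κ x := by
  obtain ⟨F, hF, h⟩ := κ.exists_measurable_map_eq_unitInterval
  have hi : Measurable (Set.inclusion (Set.Ioo_subset_Icc_self (a := (0 : ℝ)) (b := 1))) :=
    measurable_inclusion _
  refine ⟨fun p => F p.1 (Set.inclusion Set.Ioo_subset_Icc_self p.2),
    hF.comp (measurable_fst.prodMk (hi.comp measurable_snd)), fun x => ?_⟩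
  rw [← h x, ← map_inclusion_Ioo_unitInterval, Measure.map_map hF.of_uncurry_left hi]
  rfl

/-- Representability by noise in terms of the laws of the given pairs. -/
theorem noiseRepresentable_iff {G 𝒳 𝒵 𝒴 : Type u} [Group G] {Ω Ω' : Type*}
    [MeasurableSpace Ω] [MeasurableSpace Ω']
    [MeasurableSpace 𝒳] [MeasurableSpace 𝒵] [MeasurableSpace 𝒴]
    [MulAction G 𝒳] [MulAction G 𝒵] [MulAction G 𝒴]
    {P : Measure Ω} [IsProbabilityMeasure P] {X : Ω → 𝒳} {Z : Ω → 𝒵} {P' : Measure Ω'}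
    {X' : Ω' → 𝒳} {Y' : Ω' → 𝒴}
    (hX : Measurable X) (hZ : Measurable Z) (hX' : Measurable X') (hY' : Measurable Y') :
    NoiseRepresentable G P X Z P' X' Y' ↔ ∃ f : 𝒳 × 𝒵 × Set.Ioo (0 : ℝ) 1 → 𝒴, Measurable f ∧
      JointlyEquivariant G (P.map (fun ω => (X ω, Z ω))) f ∧
      ((P.map (fun ω => (X ω, Z ω))).prod uniformIoo).map (fun w => (w.1.1, f (w.1.1, w.1.2, w.2))) =
        P'.map (fun ω => (X' ω, Y' ω)) := by
  have hXZ : Measurable fun ω => (X ω, Z ω) := hX.prodMk hZ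
  have := Measure.isProbabilityMeasure_map (μ := P) hXZ.aemeasurable
  constructor
  · rintro ⟨f, hf, hfe, Ω'', _, P'', X'', Y'', Z'', ε, _, hXY, hXZ'', hε, hlaw, hind, hae⟩
    refine ⟨f, hf, hfe, ?_⟩
    have hF : Measurable fun w : (𝒳 × 𝒵) × Set.Ioo (0 : ℝ) 1 =>
      (w.1.1, f (w.1.1, w.1.2, w.2)) := by fun_prop
    -- Independence identifies the joint law of the input pair and the noise as a product, so only
    -- laws matter.
    have hjoint := (indepFun_iff_map_prod_eq_prod_map_map hXZ''.aemeasurable_fst hε).1 hind.symm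
    rw [hXZ''.map_eq, hlaw] at hjoint
    rw [← hjoint, ← hXY.map_eq, AEMeasurable.map_map_of_aemeasurable hF.aemeasurable
      (hXZ''.aemeasurable_fst.prodMk hε)]
    refine Measure.map_congr ?_
    filter_upwards [hae] with ω hω
    simp [hω]
  · rintro ⟨f, hf, hfe, hmap⟩
    -- The canonical product space carries the required copies, as coordinates and `f` of them.
    refine ⟨f, hf, hfe, (𝒳 × 𝒵) × Set.Ioo (0 : ℝ) 1, inferInstance,
      (P.map (fun ω => (X ω, Z ω))).prod uniformIoo, fun w => w.1.1,
      fun w => f (w.1.1, w.1.2, w.2), fun w => w.1.2, fun w => w.2, inferInstance,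
      ⟨by fun_prop, (hX'.prodMk hY').aemeasurable, hmap⟩, ⟨by fun_prop, hXZ.aemeasurable, ?_⟩,
      by fun_prop, ?_, ?_, Eventually.of_forall fun _ => rfl⟩
    · change Measure.map Prod.fst _ = _
      rw [Measure.map_fst_prod, measure_univ, one_smul]
    · change Measure.map Prod.snd _ = uniformIoo
      rw [Measure.map_snd_prod, measure_univ, one_smul]
    · exact (indepFun_prod (X := id) (Y := id) measurable_id measurable_id).symm

/-! ### Laws of pairs built from kernels and noise -/

section Laws

variable {𝒳 𝒵 𝒴 E : Type*} [MeasurableSpace 𝒳] [MeasurableSpace 𝒵] [MeasurableSpace 𝒴]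
  [MeasurableSpace E]

/-- The law of `(x, f (x, z, e))` when `f (x, z, ·)` has law `κ x`, for almost all `(x, z)`. -/
theorem map_prod_eq_compProd {ρ : Measure (𝒳 × 𝒵)} [SFinite ρ] {ν : Measure E} [SFinite ν]
    {f : 𝒳 × 𝒵 × E → 𝒴} (hf : Measurable f) (κ : Kernel 𝒳 𝒴) [IsSFiniteKernel κ]
    (h : ∀ᵐ w ∂ρ, ν.map (fun e => f (w.1, w.2, e)) = κ w.1) :
    (ρ.prod ν).map (fun w => (w.1.1, f (w.1.1, w.1.2, w.2))) = (ρ.map Prod.fst).compProd κ := by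
  ext s hs
  have hF : Measurable fun w : (𝒳 × 𝒵) × E => (w.1.1, f (w.1.1, w.1.2, w.2)) := by fun_prop
  rw [Measure.map_apply hF hs, Measure.prod_apply (hF hs), Measure.compProd_apply hs,
    lintegral_map (Kernel.measurable_kernel_prodMk_left hs) measurable_fst]
  refine lintegral_congr_ae ?_
  filter_upwards [h] with w hw
  have hfw : Measurable fun e => f (w.1, w.2, e) := by fun_prop
  rw [← hw, Measure.map_apply hfw (measurable_prodMk_left hs)]
  rfl

/-- The kernel `x ↦` law of `f (x, z, e)` for `z ~ μ x` and independent `e ~ ν`. -/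
noncomputable def pushNoise (μ : Kernel 𝒳 𝒵) (ν : Measure E) (f : 𝒳 × 𝒵 × E → 𝒴) : Kernel 𝒳 𝒴 :=
  (Kernel.id ×ₖ (μ ×ₖ Kernel.const 𝒳 ν)).map f

theorem pushNoise_apply {μ : Kernel 𝒳 𝒵} [IsSFiniteKernel μ] {ν : Measure E} [SFinite ν]
    {f : 𝒳 × 𝒵 × E → 𝒴} (hf : Measurable f) (x : 𝒳) :
    pushNoise μ ν f x = ((μ x).prod ν).map (fun p => f (x, p)) := by
  rw [pushNoise, Kernel.map_apply _ hf, Kernel.prod_apply, Kernel.prod_apply, Kernel.const_apply,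
    Kernel.id_apply, Measure.dirac_prod, Measure.map_map hf measurable_prodMk_left]
  rfl

/-- Here the law of `f (x, z, ·)` may depend on `z`; by Fubini, averaging over `z ~ μ x` absorbs
this dependence into the kernel. -/
theorem map_prod_eq_compProd_pushNoise {ρ : Measure 𝒳} [SFinite ρ] {ν : Measure E} [SFinite ν]
    {f : 𝒳 × 𝒵 × E → 𝒴} (hf : Measurable f) (μ : Kernel 𝒳 𝒵) [IsSFiniteKernel μ] :
    ((ρ.compProd μ).prod ν).map (fun w => (w.1.1, f (w.1.1, w.1.2, w.2))) =
      ρ.compProd (pushNoise μ ν f) := by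
  have : IsSFiniteKernel (pushNoise μ ν f) := by unfold pushNoise; infer_instance
  ext s hs
  have hF : Measurable fun w : (𝒳 × 𝒵) × E => (w.1.1, f (w.1.1, w.1.2, w.2)) := by fun_prop
  rw [Measure.map_apply hF hs, Measure.prod_apply (hF hs), Measure.compProd_apply hs,
    Measure.lintegral_compProd (measurable_measure_prodMk_left (hF hs))]
  refine lintegral_congr fun x => ?_
  have hfx : Measurable fun p : 𝒵 × E => f (x, p) := by fun_prop
  rw [pushNoise_apply hf, Measure.map_apply hfx (measurable_prodMk_left hs),
    Measure.prod_apply (hfx (measurable_prodMk_left hs))]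
  rfl

end Laws

/-! ### The implications between freeness, equivariance and representability -/

section Characterization

variable {G 𝒳 𝒵 𝒴 : Type u} {Ω : Type v} {Ω' : Type*} [Group G] [TopologicalSpace G]
  [TopologicalSpace 𝒳] [MeasurableSpace 𝒳] [BorelSpace 𝒳] [MulAction G 𝒳]
  [MeasurableSpace 𝒵] [MulAction G 𝒵]
  [TopologicalSpace 𝒴] [MeasurableSpace 𝒴] [BorelSpace 𝒴] [MulAction G 𝒴] [ContinuousSMul G 𝒴]
  [MeasurableSpace Ω] {P : Measure Ω} [IsProbabilityMeasure P] {X : Ω → 𝒳} {Z : Ω → 𝒵}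
  [MeasurableSpace Ω'] {P' : Measure Ω'} [IsProbabilityMeasure P'] {X' : Ω' → 𝒳} {Y' : Ω' → 𝒴}

/-- An equivariant conditional distribution is represented by noise acting freely. -/
theorem EquivariantCondDistrib.noiseRepresentable
    [IsTopologicalGroup G] [LocallyCompactSpace G] [SecondCountableTopology G] [T2Space G]
    [PolishSpace 𝒳] [ProperSMul G 𝒳]
    [TopologicalSpace 𝒵] [PolishSpace 𝒵] [BorelSpace 𝒵] [ContinuousSMul G 𝒵] [PolishSpace 𝒴]
    (hX : Measurable X) (hZ : Measurable Z)
    (hX' : Measurable X') (hY' : Measurable Y') (hXX' : IdentDistrib X' X P' P)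
    (hfree : EssentiallyFree G (P.map (fun ω => (X ω, Z ω))))
    (h : EquivariantCondDistrib G P' Y' X') : NoiseRepresentable G P X Z P' X' Y' := by
  let _ : MeasurableSpace G := borel G
  have : BorelSpace G := ⟨rfl⟩
  have := PolishSpace.of_locallyCompactGroup G
  have : Nonempty Ω' := nonempty_of_isProbabilityMeasure P'
  have : Nonempty 𝒴 := this.map Y'
  have hXZ : Measurable fun ω => (X ω, Z ω) := hX.prodMk hZ
  obtain ⟨κ, _, hκ, hlaw⟩ := h
  obtain ⟨F, hF, hFκ⟩ := κ.exists_measurable_map_eq_Ioo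
  obtain ⟨τ, hτ, hτe⟩ := exists_measurable_equivariant_to_group G (W := 𝒳 × 𝒵)
  -- On free pairs `τ⁻¹ • x` is invariant, so the noise acts at a canonical point of the orbit and
  -- the outer `τ` carries the equivariance.
  let f : 𝒳 × 𝒵 × Set.Ioo (0 : ℝ) 1 → 𝒴 := fun p =>
    τ (p.1, p.2.1) • F ((τ (p.1, p.2.1))⁻¹ • p.1, p.2.2)
  have hf : Measurable f := by fun_prop
  refine (noiseRepresentable_iff hX hZ hX' hY').2 ⟨f, hf,
    ⟨{w | MulAction.stabilizer G w = ⊥}, measurableSet_stabilizer_eq_bot,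
      fun g w hw => (stabilizer_smul_eq_bot_iff g w).2 hw, hfree, fun g x z e hw => ?_⟩, ?_⟩
  · have := hτe _ hw g
    simp only [Prod.smul_mk] at this
    simp only [f, this, mul_inv_rev, mul_smul, inv_smul_smul]
  · have hfst : (P.map fun ω => (X ω, Z ω)).map Prod.fst = P'.map X' := by
      rw [hXX'.map_eq, Measure.map_map measurable_fst hXZ]
      rfl
    rw [hlaw, ← hfst]
    -- Equivariance of `κ` gives the law at every pair, whatever the value of `τ`; freeness matters
    -- only for equivariance of `f`.
    refine map_prod_eq_compProd hf κ (Eventually.of_forall fun w => ?_)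
    have h1 : Measurable fun e : Set.Ioo (0 : ℝ) 1 => F ((τ w)⁻¹ • w.1, e) := by fun_prop
    have h2 : Measurable fun y : 𝒴 => τ w • y := measurable_const_smul _
    change uniformIoo.map
      ((fun y : 𝒴 => τ w • y) ∘ fun e => F ((τ w)⁻¹ • w.1, e)) = _
    rw [← Measure.map_map h2 h1, hFκ, ← hκ, smul_inv_smul]

/-- A variable represented by equivariant noise has an equivariant conditional distribution. -/
theorem NoiseRepresentable.equivariantCondDistrib
    [IsTopologicalGroup G] [LocallyCompactSpace G] [SecondCountableTopology G]
    [PolishSpace 𝒳] [ProperSMul G 𝒳]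
    [TopologicalSpace 𝒵] [BorelSpace 𝒵] [ContinuousSMul G 𝒵]
    (hX : Measurable X) (hZ : Measurable Z)
    (hX' : Measurable X') (hY' : Measurable Y') (hXX' : IdentDistrib X' X P' P)
    (hZX : EquivariantCondDistrib G P Z X)
    (h : NoiseRepresentable G P X Z P' X' Y') : EquivariantCondDistrib G P' Y' X' := by
  let _ : MeasurableSpace G := borel G
  have : BorelSpace G := ⟨rfl⟩
  have : Nonempty Ω' := nonempty_of_isProbabilityMeasure P'
  obtain ⟨y₀⟩ : Nonempty 𝒴 := this.map Y'
  obtain ⟨μ, _, hμ, hμlaw⟩ := hZX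
  obtain ⟨ρ, _, hρ⟩ := exists_equivariant_kernel_to_group G 𝒳
  obtain ⟨f, hf, ⟨S, hS, hSinv, hSae, hSf⟩, hlaw⟩ := (noiseRepresentable_iff hX hZ hX' hY').1 h
  have := Measure.isProbabilityMeasure_map (μ := P) hX.aemeasurable
  rw [hμlaw] at hSae hlaw
  rw [map_prod_eq_compProd_pushNoise hf μ] at hlaw
  -- Over `A` the function `f` is equivariant for `μ x`-almost every `z`, which suffices for the
  -- integrated law. `A` is invariant because `S` is invariant and `μ` equivariant.
  let A : Set 𝒳 := {x | ∀ᵐ z ∂μ x, (x, z) ∈ S}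
  have hA : MeasurableSet A :=
    Kernel.measurable_kernel_prodMk_left (κ := μ) hS.compl (measurableSet_singleton 0)
  have hAae : ∀ᵐ x ∂P.map X, x ∈ A := Measure.ae_ae_of_ae_compProd hSae
  have hAsub : ∀ (g : G) x, x ∈ A → g • x ∈ A := by
    intro g x hx
    change ∀ᵐ z ∂μ (g • x), (g • x, z) ∈ S
    rw [hμ, ae_map_iff (measurable_const_smul g).aemeasurable (measurable_prodMk_left hS)]
    filter_upwards [hx] with z hz using hSinv g _ hz
  have hAinv : ∀ (g : G) x, g • x ∈ A ↔ x ∈ A := fun g x =>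
    ⟨fun h => by simpa using hAsub g⁻¹ _ h, hAsub g x⟩
  let κ₀ : Kernel 𝒳 𝒴 := pushNoise μ uniformIoo f
  have : IsMarkovKernel κ₀ := Kernel.IsMarkovKernel.map _ hf
  have hy₀ : Measurable fun g : G => g • y₀ := by fun_prop
  -- On the null set `Aᶜ` any equivariant kernel will do; the orbit map of an arbitrary `y₀`
  -- transports one from `G`.
  let η : Kernel 𝒳 𝒴 := ρ.map fun g => g • y₀
  have : IsMarkovKernel η := Kernel.IsMarkovKernel.map _ hy₀
  classical
  refine ⟨Kernel.piecewise hA κ₀ η, inferInstance, fun g x => ?_, ?_⟩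
  · have hg : Measurable fun y : 𝒴 => g • y := measurable_const_smul g
    simp only [Kernel.piecewise_apply, hAinv]
    split_ifs with hx
    · have hgx : Measurable fun p : 𝒵 × Set.Ioo (0 : ℝ) 1 => f (g • x, p) := by fun_prop
      have hfx : Measurable fun p : 𝒵 × Set.Ioo (0 : ℝ) 1 => f (x, p) := by fun_prop
      have hgz : Measurable fun z : 𝒵 => g • z := measurable_const_smul g
      rw [pushNoise_apply hf, pushNoise_apply hf, hμ, Measure.map_map hg hfx]
      have hprod : ((μ x).map fun z => g • z).prod uniformIoo =
          ((μ x).prod uniformIoo).map (Prod.map (fun z => g • z) id) := by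
        rw [← Measure.map_prod_map _ _ hgz measurable_id, Measure.map_id]
      rw [hprod, Measure.map_map hgx (hgz.prodMap measurable_id)]
      refine Measure.map_congr ?_
      have hfst : ∀ᵐ p ∂(μ x).prod uniformIoo, (x, p.1) ∈ S :=
        Measure.quasiMeasurePreserving_fst.ae hx
      filter_upwards [hfst] with p hp using hSf g x p.1 p.2 hp
    · rw [Kernel.map_apply _ hy₀, Kernel.map_apply _ hy₀, hρ,
        Measure.map_map hy₀ (measurable_const_smul g), Measure.map_map hg hy₀]
      congr 1
      ext k
      simp [mul_smul]
  · rw [← hlaw, hXX'.map_eq]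
    refine Measure.compProd_congr ?_
    filter_upwards [hAae] with x hx
    rw [Kernel.piecewise_apply, if_pos hx]

/-- Equivariant noise acting freely on pairs represents exactly the variables with an equivariant
conditional distribution. -/
theorem noiseCharacterizes
    [IsTopologicalGroup G] [LocallyCompactSpace G] [SecondCountableTopology G] [T2Space G]
    [PolishSpace 𝒳] [ProperSMul G 𝒳]
    [TopologicalSpace 𝒵] [PolishSpace 𝒵] [BorelSpace 𝒵] [ContinuousSMul G 𝒵] [PolishSpace 𝒴]
    (hX : Measurable X) (hZ : Measurable Z)
    (hfree : EssentiallyFree G (P.map (fun ω => (X ω, Z ω))))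
    (hZX : EquivariantCondDistrib G P Z X) : NoiseCharacterizes G P X Z 𝒴 :=
  fun _ _ _ _ _ _ hX' hY' hXX' =>
    ⟨fun h => h.noiseRepresentable hX hZ hX' hY' hXX' hfree,
      fun h => h.equivariantCondDistrib hX hZ hX' hY' hXX' hZX⟩

/-- Testing on `𝒳 × 𝒵` shows that the noise is equivariant. -/
theorem equivariantCondDistrib_of_noiseCharacterizes [SecondCountableTopology 𝒳]
    [ContinuousConstSMul G 𝒳]
    [TopologicalSpace 𝒵] [PolishSpace 𝒵] [BorelSpace 𝒵] [ContinuousSMul G 𝒵]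
    (hX : Measurable X) (hZ : Measurable Z)
    (h : NoiseCharacterizes G P X Z (𝒳 × 𝒵)) : EquivariantCondDistrib G P Z X := by
  have hXZ : Measurable fun ω => (X ω, Z ω) := hX.prodMk hZ
  have := Measure.isProbabilityMeasure_map (μ := P) hXZ.aemeasurable
  have hid : IdentDistrib Prod.fst X (P.map fun ω => (X ω, Z ω)) P :=
    ⟨by fun_prop, hX.aemeasurable, by rw [Measure.map_map measurable_fst hXZ]; rfl⟩
  -- The pair represents itself through `(x, z, e) ↦ (x, z)`. Keeping the factor `𝒳` in the output
  -- makes the test space proper even when `𝒵` is not.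
  have hrep : NoiseRepresentable G P X Z (P.map fun ω => (X ω, Z ω)) Prod.fst id := by
    refine (noiseRepresentable_iff hX hZ measurable_fst measurable_id).2
      ⟨fun p => (p.1, p.2.1), by fun_prop,
        ⟨Set.univ, MeasurableSet.univ, by simp, by simp, fun g x z e _ => rfl⟩, ?_⟩
    have hfst : P.map (fun ω => (X ω, Z ω)) =
        ((P.map fun ω => (X ω, Z ω)).prod uniformIoo).map Prod.fst := by
      rw [Measure.map_fst_prod, measure_univ, one_smul]
    conv_rhs => rw [hfst, Measure.map_map (by fun_prop) measurable_fst]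
    rfl
  obtain ⟨κ, _, hκ, hlaw⟩ := (h _ _ _ _ measurable_fst measurable_id hid).2 hrep
  refine ⟨κ.map Prod.snd, Kernel.IsMarkovKernel.map _ measurable_snd, fun g x => ?_, ?_⟩
  · rw [Kernel.map_apply _ measurable_snd, Kernel.map_apply _ measurable_snd, hκ,
      Measure.map_map measurable_snd (measurable_const_smul g),
      Measure.map_map (measurable_const_smul g) measurable_snd]
    rfl
  · rw [hid.map_eq] at hlaw
    have hmap : Measurable (Prod.map id Prod.snd : 𝒳 × 𝒳 × 𝒵 → 𝒳 × 𝒵) := by fun_prop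
    have := congrArg (Measure.map (Prod.map id Prod.snd)) hlaw
    rw [Measure.map_map hmap (by fun_prop), Measure.map_map (by fun_prop) hXZ] at this
    rw [Measure.compProd_map measurable_snd, ← this]
    rfl

/-- Testing on the group itself shows that the action on pairs is essentially free. -/
theorem essentiallyFree_of_noiseCharacterizes
    [IsTopologicalGroup G] [LocallyCompactSpace G] [SecondCountableTopology G]
    [MeasurableSpace G] [BorelSpace G] [PolishSpace 𝒳] [ProperSMul G 𝒳]
    (hX : Measurable X) (h : NoiseCharacterizes G P X Z G) :
    EssentiallyFree G (P.map (fun ω => (X ω, Z ω))) := by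
  have := Measure.isProbabilityMeasure_map (μ := P) hX.aemeasurable
  obtain ⟨ρ, _, hρ⟩ := exists_equivariant_kernel_to_group G 𝒳
  have hid : IdentDistrib Prod.fst X ((P.map X).compProd ρ) P :=
    ⟨by fun_prop, hX.aemeasurable, Measure.fst_compProd _ _⟩
  have hcond : EquivariantCondDistrib G ((P.map X).compProd ρ) Prod.snd Prod.fst :=
    ⟨ρ, inferInstance, hρ, by rw [hid.map_eq]; exact Measure.map_id⟩
  obtain ⟨f, -, ⟨S, -, -, hSae, hSf⟩, -⟩ :=
    (h _ _ _ _ measurable_fst measurable_snd hid).1 hcond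
  filter_upwards [hSae] with w hw
  rw [Subgroup.eq_bot_iff_forall]
  intro g hg
  obtain ⟨hg1, hg2⟩ := Prod.ext_iff.1 (MulAction.mem_stabilizer_iff.1 hg)
  simp only [Prod.smul_fst, Prod.smul_snd] at hg1 hg2
  -- The noise value `1 / 2` is arbitrary. An element fixing the pair also fixes its image in `G`,
  -- so it is the identity.
  have hf := hSf g w.1 w.2 ⟨1 / 2, by norm_num, by norm_num⟩ hw
  rw [hg1, hg2] at hf
  simpa using hf

end Characterization

/-- The stabilizer of a pair is contained in that of its second component. -/
theorem essentiallyFree_prod_of_snd {G 𝒳 𝒵 : Type*} {Ω : Type*} [Group G] [MeasurableSpace 𝒳]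
    [MeasurableSpace 𝒵] [MulAction G 𝒳] [MulAction G 𝒵] [MeasurableSpace Ω] {P : Measure Ω}
    {X : Ω → 𝒳} {Z : Ω → 𝒵} (hX : Measurable X) (hZ : Measurable Z)
    (h : EssentiallyFree G (P.map Z)) : EssentiallyFree G (P.map (fun ω => (X ω, Z ω))) := by
  have hsnd : (P.map fun ω => (X ω, Z ω)).map Prod.snd = P.map Z := by
    rw [Measure.map_map measurable_snd (hX.prodMk hZ)]; rfl
  unfold EssentiallyFree at h
  rw [← hsnd] at h
  filter_upwards [ae_of_ae_map measurable_snd.aemeasurable h] with w hw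
  rw [Subgroup.eq_bot_iff_forall] at hw ⊢
  intro g hg
  exact hw g (congrArg Prod.snd (MulAction.mem_stabilizer_iff.1 hg))

end Auxiliary

/-- Noise injection. -/
theorem mainTheorem4 {G 𝒳 𝒵 : Type u} {Ω : Type v}
    [Group G] [TopologicalSpace G] [IsTopologicalGroup G] [LocallyCompactSpace G]
    [SecondCountableTopology G] [T2Space G]
    [TopologicalSpace 𝒳] [PolishSpace 𝒳] [MeasurableSpace 𝒳] [BorelSpace 𝒳]
    [MulAction G 𝒳] [ProperSMul G 𝒳]
    [TopologicalSpace 𝒵] [PolishSpace 𝒵] [MeasurableSpace 𝒵] [BorelSpace 𝒵]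
    [MulAction G 𝒵] [ContinuousSMul G 𝒵]
    [MeasurableSpace Ω] (P : Measure Ω) [IsProbabilityMeasure P]
    (X : Ω → 𝒳) (Z : Ω → 𝒵) (hX : Measurable X) (hZ : Measurable Z) :
    List.TFAE [
      -- free action on pairs, and equivariant noise
      EssentiallyFree G (P.map (fun ω => (X ω, Z ω))) ∧ EquivariantCondDistrib G P Z X,
      -- the representation, for all output spaces with a continuous action
      ∀ (𝒴 : Type u) [TopologicalSpace 𝒴] [PolishSpace 𝒴] [MeasurableSpace 𝒴] [BorelSpace 𝒴]
        [MulAction G 𝒴] [ContinuousSMul G 𝒴], NoiseCharacterizes G P X Z 𝒴,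
      -- the representation, for all output spaces with a proper action
      ∀ (𝒴 : Type u) [TopologicalSpace 𝒴] [PolishSpace 𝒴] [MeasurableSpace 𝒴] [BorelSpace 𝒴]
        [MulAction G 𝒴] [ProperSMul G 𝒴], NoiseCharacterizes G P X Z 𝒴] ∧
    -- free action on the noise space alone suffices
    (EssentiallyFree G (P.map Z) ∧ EquivariantCondDistrib G P Z X →
      ∀ (𝒴 : Type u) [TopologicalSpace 𝒴] [PolishSpace 𝒴] [MeasurableSpace 𝒴] [BorelSpace 𝒴]
        [MulAction G 𝒴] [ContinuousSMul G 𝒴], NoiseCharacterizes G P X Z 𝒴) := by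
  have main : EssentiallyFree G (P.map (fun ω => (X ω, Z ω))) ∧ EquivariantCondDistrib G P Z X →
      ∀ (𝒴 : Type u) [TopologicalSpace 𝒴] [PolishSpace 𝒴] [MeasurableSpace 𝒴] [BorelSpace 𝒴]
        [MulAction G 𝒴] [ContinuousSMul G 𝒴], NoiseCharacterizes G P X Z 𝒴 := by
    intro h 𝒴 _ _ _ _ _ _
    exact noiseCharacterizes hX hZ h.1 h.2
  refine ⟨?_, fun h => main ⟨essentiallyFree_prod_of_snd hX hZ h.1, h.2⟩⟩
  tfae_have 1 → 2 := main
  tfae_have 2 → 3 := by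
    intro h 𝒴 _ _ _ _ _ _
    exact h 𝒴
  tfae_have 3 → 1 := by
    intro h
    let _ : MeasurableSpace G := borel G
    have : BorelSpace G := ⟨rfl⟩
    have := PolishSpace.of_locallyCompactGroup G
    -- Both test spaces are proper: `G` under left translation, and `𝒳 × 𝒵` by properness of its
    -- first factor.
    exact ⟨essentiallyFree_of_noiseCharacterizes hX (h G),
      equivariantCondDistrib_of_noiseCharacterizes hX hZ (h (𝒳 × 𝒵))⟩
  tfae_finish
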